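/- All graphs are finite, simple and undirected. For a graph $G$ with adjacency matrix $A_G$, consider the continuous-time quantum walk $t\mapsto e^{-itA_G}$. There is perfect state transfer in $G$ from a vertex $a$ to a vertex $b$ at time $t$ if $|\langle b|e^{-itA_G}|a\rangle|=1$. The graph $G$ is periodic if for every unit vector $|\psi\rangle$ in $\mathbb{C}^{V(G)}$ there is a time $t>0$ such that $|\langle\psi|e^{-itA_G}|\psi\rangle|=1$. For every integer $\ell\ge 2$, let $\mathcal{G}_\ell=\overline{K}_2+(C_{2(2\ell-1)}\,\square\,C_{2\ell+1})$ be the join of two non-adjacent vertices with the Cartesian product of the cycles on $2(2\ell-1)$ and $2\ell+1$ vertices. Then $\mathcal{G}_\ell$ is connected and not periodic, and there is a time $t>0$ at which it has perfect state transfer between the two vertices of $\overline{K}_2$ (in both directions). In particular, there are connected non-periodic graphs, of infinitely many different orders, that have perfect state transfer between two distinct vertices; this answers affirmatively Godsil's question whether non-periodic graphs with perfect state transfer exist. -/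

import Mathlib

open scoped Matrix

/-- The join of two graphs: their disjoint union together with all edges between the two parts. -/
def graphJoin {V W : Type*} (G : SimpleGraph V) (H : SimpleGraph W) : SimpleGraph (V ⊕ W) where
  Adj
    | Sum.inl u, Sum.inl v => G.Adj u v
    | Sum.inr u, Sum.inr v => H.Adj u v
    | Sum.inl _, Sum.inr _ => True
    | Sum.inr _, Sum.inl _ => True
  symm.symm
    | Sum.inl u, Sum.inl v => G.adj_symm
    | Sum.inr u, Sum.inr v => H.adj_symm
    | Sum.inl _, Sum.inr _ | Sum.inr _, Sum.inl _ => id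
  loopless.irrefl
    | Sum.inl u => G.irrefl
    | Sum.inr u => H.irrefl

/-- The complement of the join is the disjoint union of the complements. -/
theorem compl_graphJoin {V W : Type*} (G : SimpleGraph V) (H : SimpleGraph W) :
    (graphJoin G H)ᶜ = SimpleGraph.sum Gᶜ Hᶜ := by
  ext (u | u) (v | v) <;> simp [graphJoin]

open Classical in
/-- The transition matrix `exp(-i t A)` at time `t` of the continuous-time quantum walk on `G`,
where `A` is the adjacency matrix of `G`. -/
noncomputable def walkMatrix {V : Type*} [Fintype V] (G : SimpleGraph V) (t : ℝ) : Matrix V V ℂ :=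
  NormedSpace.exp ((-(Complex.I * (t : ℂ))) • G.adjMatrix ℂ)

/-- Perfect state transfer on `G` from `a` to `b` at time `t`: `|⟨b| exp(-i t A) |a⟩| = 1`. -/
def PerfectStateTransferAt {V : Type*} [Fintype V] (G : SimpleGraph V) (a b : V) (t : ℝ) : Prop :=
  ‖walkMatrix G t b a‖ = 1

/-- `G` is periodic if every state (unit vector) `ψ` returns to itself up to a phase at some
positive time `t`: `|⟨ψ| exp(-i t A) |ψ⟩| = 1`. -/
def IsPeriodicGraph {V : Type*} [Fintype V] (G : SimpleGraph V) : Prop :=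
  ∀ ψ : V → ℂ, star ψ ⬝ᵥ ψ = 1 → ∃ t : ℝ, 0 < t ∧ ‖star ψ ⬝ᵥ (walkMatrix G t *ᵥ ψ)‖ = 1

/-- The double cone over `H`: the join of `H` with two non-adjacent vertices. -/
def doubleCone {W : Type*} (H : SimpleGraph W) : SimpleGraph (Fin 2 ⊕ W) :=
  graphJoin (⊤ : SimpleGraph (Fin 2))ᶜ H

/-- The double cone over the Cartesian product of the cycles with `2(2ℓ-1)` and `2ℓ+1` vertices. -/
def coneGrid (l : ℕ) : SimpleGraph (Fin 2 ⊕ (Fin (2 * (2 * l - 1)) × Fin (2 * l + 1))) :=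
  doubleCone (SimpleGraph.boxProd (SimpleGraph.cycleGraph (2 * (2 * l - 1)))
    (SimpleGraph.cycleGraph (2 * l + 1)))

/-!
Let `H = C_m □ C_n` with `m = 2(2l - 1)` and `n = 2l + 1`. This is a `4`-regular graph on
`2(4l² - 1)` vertices. The double cone over `H` has the following eigenvectors:

* the difference `e₀ - e₁` of the two cone vertices, with eigenvalue `0`
  (`adjMatrix_doubleCone_mulVec_antisymm`);
* two vectors constant on the cone vertices and constant on `H`. Their eigenvalues are the roots
  `2(1 ± 2l)` of `θ² - 4θ - 2|H| = 0`, which are integers because `4 + 2|H| = (4l)²`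
  (`adjMatrix_doubleCone_mulVec_symm`);
* the eigenvectors of `H` orthogonal to the constants, extended by `0`, with the same eigenvalue as
  in `H` (`adjMatrix_doubleCone_mulVec_base`).

State transfer between the cone vertices involves the first two kinds only. As `1 ± 2l` is odd, at
time `π / 2` the walk fixes `e₀ - e₁` and negates `e₀ + e₁`, so it exchanges the cone vertices up to
sign (`walkMatrix_doubleCone_pi_div_two`).

Periodicity, by contrast, involves the whole spectrum. If a sum of eigenvectors with distinct
eigenvalues returns to itself up to a phase, then the phases of these eigenvalues all agree, and
therefore quotients of eigenvalue differences are rational (`IsPeriodicGraph.exists_phases_eq`,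
`IsPeriodicGraph.not_irrational_div`). The functions on `H` that depend only on the coordinate
in `C_n` give the eigenvalue `2 + 2cos(2π/n)`. By Niven's theorem it is irrational, as `n` is odd
and greater than `3`, whereas `0` and `2(2l + 1)` are also eigenvalues.
-/

/-! ### The walk on eigenvectors -/

open Classical in
/-- The walk multiplies an eigenvector with eigenvalue `θ` by the phase `exp(-i t θ)`: apply the
exponential series of the matrix to the vector term by term. -/
theorem walkMatrix_mulVec_of_eigenvector {V : Type*} [Fintype V] {G : SimpleGraph V} {v : V → ℂ}
    {θ : ℂ} (h : G.adjMatrix ℂ *ᵥ v = θ • v) (t : ℝ) :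
    walkMatrix G t *ᵥ v = Complex.exp (-(Complex.I * t) * θ) • v := by
  set c : ℂ := -(Complex.I * t)
  have hpow (n : ℕ) : (c • G.adjMatrix ℂ) ^ n *ᵥ v = (c * θ) ^ n • v := by
    induction n with
    | zero => simp
    | succ n ih =>
      rw [pow_succ, ← Matrix.mulVec_mulVec, Matrix.smul_mulVec, h, smul_smul, Matrix.mulVec_smul,
        ih, smul_smul, pow_succ, mul_comm]
  have h₁ : HasSum (fun n : ℕ => ((n.factorial : ℂ)⁻¹) • (c • G.adjMatrix ℂ) ^ n)
      (walkMatrix G t) := by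
    open scoped Matrix.Norms.Operator in
    exact NormedSpace.exp_series_hasSum_exp' (𝕂 := ℂ) (c • G.adjMatrix ℂ)
  have h₂ := h₁.map (Matrix.mulVec.addMonoidHomLeft v)
    (continuous_id.matrix_mulVec continuous_const)
  have h₃ := (NormedSpace.exp_series_hasSum_exp' (𝕂 := ℂ) (c * θ)).smul_const v
  rw [← Complex.exp_eq_exp_ℂ] at h₃
  refine h₂.unique ?_
  convert h₃ using 2 with n
  simp [Matrix.mulVec.addMonoidHomLeft, Matrix.smul_mulVec, hpow, smul_smul]

/-! ### The ratio condition for periodic graphs -/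

/-- The unit circle contains no segment: a mean, with positive weights, of unit complex numbers that
has absolute value `1` equals each of them. -/
theorem eq_sum_of_norm_sum_eq_one {ι : Type*} [Fintype ι] {p : ι → ℝ} {z : ι → ℂ}
    (hp : ∀ i, 0 < p i) (hsum : ∑ i, p i = 1) (hz : ∀ i, ‖z i‖ = 1)
    (h : ‖∑ i, (p i : ℂ) * z i‖ = 1) (i : ι) : z i = ∑ j, (p j : ℂ) * z j := by
  set S := ∑ j, (p j : ℂ) * z j
  -- Each `p j * Re (S̄ * z j)` is at most `p j`, and the sums over `j` are equal, so all these
  -- inequalities are equalities.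
  have hle (j : ι) : p j * (starRingEnd ℂ S * z j).re ≤ p j :=
    mul_le_of_le_one_right (hp j).le ((Complex.re_le_norm _).trans (by simp [h, hz]))
  have hS : ∑ j, p j * (starRingEnd ℂ S * z j).re = ∑ j, p j := by
    have : (starRingEnd ℂ S * S).re = ∑ j, p j * (starRingEnd ℂ S * z j).re := by
      conv_lhs => rw [show S = ∑ j, (p j : ℂ) * z j from rfl, Finset.mul_sum]
      simp only [Complex.re_sum]
      refine Finset.sum_congr rfl fun j _ => ?_
      rw [mul_left_comm, Complex.re_ofReal_mul]
    rw [← this, hsum, ← Complex.normSq_eq_conj_mul_self, Complex.normSq_eq_norm_sq, h]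
    simp
  have hi := (Finset.sum_eq_sum_iff_of_le fun j _ => hle j).1 hS i (Finset.mem_univ i)
  have hre : (starRingEnd ℂ S * z i).re = 1 :=
    mul_left_cancel₀ (hp i).ne' (by rw [hi, mul_one])
  have hnorm : ‖starRingEnd ℂ S * z i‖ = 1 := by simp [h, hz]
  have hone : starRingEnd ℂ S * z i = 1 := by
    have := Complex.nonneg_iff.1 (Complex.re_eq_norm.1 (hre.trans hnorm.symm))
    exact Complex.ext hre this.2.symm
  calc z i = (S * starRingEnd ℂ S) * z i := by
        rw [mul_comm S, ← Complex.normSq_eq_conj_mul_self, Complex.normSq_eq_norm_sq, h]; simp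
    _ = S := by rw [mul_assoc, hone, mul_one]

open Classical in
/-- The adjacency matrix is Hermitian, so its eigenspaces are orthogonal. -/
theorem star_dotProduct_eq_zero_of_eigenvectors {V : Type*} [Fintype V] {G : SimpleGraph V}
    {u v : V → ℂ} {α β : ℝ} (hu : G.adjMatrix ℂ *ᵥ u = (α : ℂ) • u)
    (hv : G.adjMatrix ℂ *ᵥ v = (β : ℂ) • v) (hne : α ≠ β) : star u ⬝ᵥ v = 0 := by
  have hA : (G.adjMatrix ℂ)ᴴ = G.adjMatrix ℂ := by
    ext a b
    simp [SimpleGraph.adjMatrix_apply, G.adj_comm]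
  have h : (α : ℂ) * (star u ⬝ᵥ v) = β * (star u ⬝ᵥ v) := by
    calc (α : ℂ) * (star u ⬝ᵥ v) = star ((α : ℂ) • u) ⬝ᵥ v := by
          simp [star_smul, smul_dotProduct]
      _ = star u ⬝ᵥ (G.adjMatrix ℂ *ᵥ v) := by
          rw [← hu, Matrix.star_mulVec, hA, Matrix.dotProduct_mulVec]
      _ = β * (star u ⬝ᵥ v) := by rw [hv, dotProduct_smul, smul_eq_mul]
  by_contra h0
  exact hne (by exact_mod_cast mul_right_cancel₀ h0 h)

open Classical in
/-- On a periodic graph, the phases of any finitely many distinct eigenvalues agree at some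
positive time. The state that witnesses this is the normalised sum of the eigenvectors. -/
theorem IsPeriodicGraph.exists_phases_eq {V : Type*} [Fintype V] {G : SimpleGraph V}
    (hG : IsPeriodicGraph G) {ι : Type*} [Fintype ι] [Nonempty ι] {v : ι → V → ℂ} {θ : ι → ℝ}
    (hθ : Function.Injective θ) (hv : ∀ i, v i ≠ 0)
    (h : ∀ i, G.adjMatrix ℂ *ᵥ v i = (θ i : ℂ) • v i) :
    ∃ t : ℝ, 0 < t ∧ ∀ i j, Complex.exp (-(Complex.I * t) * θ i) =
      Complex.exp (-(Complex.I * t) * θ j) := by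
  set s : ι → ℝ := fun i => ∑ x, ‖v i x‖ ^ 2
  have hself (i : ι) : star (v i) ⬝ᵥ v i = (s i : ℂ) := by
    simp [s, dotProduct, Complex.conj_mul']
  have hs (i : ι) : 0 < s i := by
    obtain ⟨x, hx⟩ := Function.ne_iff.1 (hv i)
    exact Finset.sum_pos' (fun _ _ => by positivity)
      ⟨x, Finset.mem_univ x, by have := norm_pos_iff.2 hx; positivity⟩
  have hS : 0 < ∑ i, s i := Finset.sum_pos (fun i _ => hs i) Finset.univ_nonempty
  set S := ∑ i, s i
  set c : ℂ := (((Real.sqrt S)⁻¹ : ℝ) : ℂ)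
  have hc : c * c = (S⁻¹ : ℝ) := by
    rw [← Complex.ofReal_mul, ← mul_inv, Real.mul_self_sqrt hS.le]
  set ψ : V → ℂ := c • ∑ i, v i
  -- By orthogonality, multiplying the eigencomponents of `ψ` by scalars `z i` gives a vector whose
  -- overlap with `ψ` is a weighted mean of the `z i`.
  have key (z : ι → ℂ) : star ψ ⬝ᵥ (c • ∑ i, z i • v i) = ∑ i, ((s i / S : ℝ) : ℂ) * z i := by
    have hstar : star ψ = c • ∑ i, star (v i) := by
      simp only [ψ, star_smul, star_sum, show star c = c from Complex.conj_ofReal _]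
    rw [hstar, smul_dotProduct, dotProduct_smul, smul_smul, hc, sum_dotProduct, Finset.smul_sum]
    refine Finset.sum_congr rfl fun i _ => ?_
    rw [dotProduct_sum, Finset.sum_eq_single i]
    · rw [dotProduct_smul, hself]
      push_cast
      simp only [smul_eq_mul]
      ring
    · intro j _ hji
      rw [dotProduct_smul, star_dotProduct_eq_zero_of_eigenvectors (h i) (h j)
        (hθ.ne hji.symm), smul_zero]
    · simp
  have hsum : ∑ i, s i / S = 1 := by rw [← Finset.sum_div, div_self hS.ne']
  obtain ⟨t, ht, hψ⟩ := hG ψ (by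
    have := key 1
    simp only [Pi.one_apply, one_smul, mul_one] at this
    rw [this, ← Complex.ofReal_sum, hsum, Complex.ofReal_one])
  refine ⟨t, ht, ?_⟩
  have hwalk : walkMatrix G t *ᵥ ψ =
      c • ∑ i, Complex.exp (-(Complex.I * t) * θ i) • v i := by
    simp_rw [ψ, Matrix.mulVec_smul, Matrix.mulVec_sum, walkMatrix_mulVec_of_eigenvector (h _)]
  rw [hwalk, key] at hψ
  have hmean := eq_sum_of_norm_sum_eq_one (fun i => div_pos (hs i) hS) hsum
    (fun i => by simp [Complex.norm_exp]) hψ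
  exact fun i j => (hmean i).trans (hmean j).symm

open Classical in
/-- The ratio condition with one eigenvalue equal to `0`: the quotient of any two other eigenvalues
of a periodic graph is rational. -/
theorem IsPeriodicGraph.not_irrational_div {V : Type*} [Fintype V] {G : SimpleGraph V}
    (hG : IsPeriodicGraph G) {u v w : V → ℂ} {α β : ℝ} (hα : α ≠ 0) (hβ : β ≠ 0) (hαβ : α ≠ β)
    (hu₀ : u ≠ 0) (hv₀ : v ≠ 0) (hw₀ : w ≠ 0) (hu : G.adjMatrix ℂ *ᵥ u = 0)
    (hv : G.adjMatrix ℂ *ᵥ v = (α : ℂ) • v) (hw : G.adjMatrix ℂ *ᵥ w = (β : ℂ) • w) :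
    ¬ Irrational (β / α) := by
  obtain ⟨t, ht, h⟩ := hG.exists_phases_eq (ι := Fin 3) (v := ![u, v, w]) (θ := ![0, α, β])
    (by
      intro i j
      fin_cases i <;> fin_cases j <;> simp [hα, hβ, hαβ, hα.symm, hβ.symm, hαβ.symm])
    (by intro i; fin_cases i <;> simp [hu₀, hv₀, hw₀])
    (by intro i; fin_cases i <;> simp [hu, hv, hw])
  have hint {γ : ℝ} (hγ : Complex.exp (-(Complex.I * t) * γ) = 1) :
      ∃ n : ℤ, t * γ = n * (2 * Real.pi) := by
    obtain ⟨n, hn⟩ := Complex.exp_eq_one_iff.1 hγ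
    refine ⟨-n, ?_⟩
    have : ((t * γ : ℝ) : ℂ) = ((-n * (2 * Real.pi) : ℝ) : ℂ) := by
      apply mul_left_cancel₀ (neg_ne_zero.2 Complex.I_ne_zero)
      push_cast
      linear_combination hn
    exact_mod_cast this
  obtain ⟨m, hm⟩ := hint (by simpa using h 1 0)
  obtain ⟨n, hn⟩ := hint (by simpa using h 2 0)
  have hπ := Real.two_pi_pos.ne'
  have hm0 : (m : ℝ) ≠ 0 := by
    rintro h0
    rw [h0, zero_mul] at hm
    exact mul_ne_zero ht.ne' hα hm
  rw [show β / α = ((n / m : ℚ) : ℝ) by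
    rw [← mul_div_mul_left β α ht.ne', hm, hn, mul_div_mul_right _ _ hπ]
    push_cast
    rfl]
  exact Rat.not_irrational _

/-! ### Eigenvectors of a double cone -/

theorem doubleCone_connected {W : Type*} [Nonempty W] (H : SimpleGraph W) :
    (doubleCone H).Connected := by
  have hadj (i : Fin 2) (w : W) : (doubleCone H).Adj (Sum.inl i) (Sum.inr w) := trivial
  refine (SimpleGraph.connected_iff_exists_forall_reachable _).2 ⟨Sum.inl 0, ?_⟩
  rintro (i | w)
  · obtain ⟨w⟩ := ‹Nonempty W›
    exact (hadj 0 w).reachable.trans (hadj i w).symm.reachable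
  · exact (hadj 0 w).reachable

open Classical in
theorem adjMatrix_doubleCone_mulVec {W : Type*} [Fintype W] (H : SimpleGraph W) (f : Fin 2 → ℂ)
    (g : W → ℂ) : (doubleCone H).adjMatrix ℂ *ᵥ Sum.elim f g =
      Sum.elim (fun _ => ∑ w, g w) (fun w => f 0 + f 1 + (H.adjMatrix ℂ *ᵥ g) w) := by
  ext (i | w)
  · simp [Matrix.mulVec, dotProduct, SimpleGraph.adjMatrix_apply, doubleCone, graphJoin]
  · simp [Matrix.mulVec, dotProduct, SimpleGraph.adjMatrix_apply, doubleCone, graphJoin]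

open Classical in
/-- The cone vertices have the same neighbours, so the difference of their indicators is in the
kernel of the adjacency matrix. -/
theorem adjMatrix_doubleCone_mulVec_antisymm {W : Type*} [Fintype W] (H : SimpleGraph W) :
    (doubleCone H).adjMatrix ℂ *ᵥ Sum.elim ![1, -1] 0 = 0 := by
  rw [adjMatrix_doubleCone_mulVec]
  ext (i | w) <;> simp

open Classical in
/-- The eigenvectors of a double cone over a regular graph that are constant on the cone vertices
and constant on the base. -/
theorem adjMatrix_doubleCone_mulVec_symm {W : Type*} [Fintype W] {H : SimpleGraph W}
    [H.LocallyFinite] {k : ℕ} (hH : H.IsRegularOfDegree k) {α θ : ℂ} (h₁ : 2 * α + k = θ)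
    (h₂ : (Fintype.card W : ℂ) = θ * α) :
    (doubleCone H).adjMatrix ℂ *ᵥ Sum.elim (fun _ => α) 1 = θ • Sum.elim (fun _ => α) 1 := by
  rw [adjMatrix_doubleCone_mulVec]
  have h (w : W) : (H.adjMatrix ℂ *ᵥ 1) w = k := by
    have := hH w
    rw [SimpleGraph.adjMatrix_mulVec_apply, ← this]
    simp only [Pi.one_apply, Finset.sum_const, nsmul_one, SimpleGraph.card_neighborFinset_eq_degree]
    congr!
  ext (i | w)
  · simp [h₂]
  · simp [h, ← h₁, two_mul]

open Classical in
/-- An eigenvector of the base whose entries sum to `0` extends by `0` to the double cone. -/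
theorem adjMatrix_doubleCone_mulVec_base {W : Type*} [Fintype W] {H : SimpleGraph W} {g : W → ℂ}
    {θ : ℂ} (hg : H.adjMatrix ℂ *ᵥ g = θ • g) (h₀ : ∑ w, g w = 0) :
    (doubleCone H).adjMatrix ℂ *ᵥ Sum.elim 0 g = θ • Sum.elim (0 : Fin 2 → ℂ) g := by
  rw [adjMatrix_doubleCone_mulVec, hg]
  ext (i | w) <;> simp [h₀]

/-! ### Perfect state transfer -/

/-- Let the base have `2(2l - 1)(2l + 1)` vertices. The eigenvalues on the span of the cone
vertices and the constants on the base are then `0` and `2(1 ± 2l)`. At time `π / 2` the walk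
therefore fixes `e₀ - e₁` and negates `e₀ + e₁`, so it maps `e₀` to `-e₁` and `e₁` to `-e₀`. -/
theorem walkMatrix_doubleCone_pi_div_two {W : Type*} [Fintype W] {H : SimpleGraph W}
    [H.LocallyFinite] {l : ℕ} (hl : l ≠ 0) (hH : H.IsRegularOfDegree 4)
    (hW : (Fintype.card W : ℂ) = 2 * (2 * l - 1) * (2 * l + 1)) :
    walkMatrix (doubleCone H) (Real.pi / 2) (Sum.inl 1) (Sum.inl 0) = -1 ∧
      walkMatrix (doubleCone H) (Real.pi / 2) (Sum.inl 0) (Sum.inl 1) = -1 := by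
  set U := walkMatrix (doubleCone H) (Real.pi / 2)
  -- The eigenvalues `2(1 ± 2l)` are twice an odd integer.
  have hexp (m : ℤ) :
      Complex.exp (-(Complex.I * (Real.pi / 2 : ℝ)) * (2 * (2 * m + 1))) = -1 := by
    rw [show -(Complex.I * (Real.pi / 2 : ℝ)) * (2 * (2 * m + 1)) =
      Real.pi * Complex.I + (-m - 1 : ℤ) * (2 * Real.pi * Complex.I) by push_cast; ring,
      Complex.exp_add, Complex.exp_int_mul_two_pi_mul_I, Complex.exp_pi_mul_I, mul_one]
  have hd : U *ᵥ Sum.elim ![1, -1] 0 = Sum.elim ![1, -1] 0 := by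
    have := walkMatrix_mulVec_of_eigenvector (θ := 0)
      ((adjMatrix_doubleCone_mulVec_antisymm H).trans (zero_smul ℂ _).symm) (Real.pi / 2)
    simpa using this
  have hp : U *ᵥ Sum.elim (fun _ => (2 * l - 1 : ℂ)) 1 = -Sum.elim (fun _ => (2 * l - 1 : ℂ)) 1 := by
    have := walkMatrix_mulVec_of_eigenvector (adjMatrix_doubleCone_mulVec_symm hH
      (α := 2 * l - 1) (θ := 2 * (2 * (l : ℤ) + 1)) (by push_cast; ring)
      (by rw [hW]; push_cast; ring)) (Real.pi / 2)
    rwa [hexp, neg_one_smul] at this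
  have hm : U *ᵥ Sum.elim (fun _ => (-2 * l - 1 : ℂ)) 1 =
      -Sum.elim (fun _ => (-2 * l - 1 : ℂ)) 1 := by
    have := walkMatrix_mulVec_of_eigenvector (adjMatrix_doubleCone_mulVec_symm hH
      (α := -2 * l - 1) (θ := 2 * (2 * (-l : ℤ) + 1)) (by push_cast; ring)
      (by rw [hW]; push_cast; ring)) (Real.pi / 2)
    rwa [hexp, neg_one_smul] at this
  have hl' : (l : ℂ) ≠ 0 := by exact_mod_cast hl
  -- `e₀ + e₁` is a multiple of the difference of the two eigenvectors, both of which are negated.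
  have hs : U *ᵥ Sum.elim (1 : Fin 2 → ℂ) (0 : W → ℂ) =
      -Sum.elim (1 : Fin 2 → ℂ) (0 : W → ℂ) := by
    have : (Sum.elim 1 0 : Fin 2 ⊕ W → ℂ) = (4 * l : ℂ)⁻¹ •
        (Sum.elim (fun _ => (2 * l - 1 : ℂ)) 1 - Sum.elim (fun _ => (-2 * l - 1 : ℂ)) 1) := by
      ext (i | w)
      · simp
        field_simp
        ring
      · simp
    rw [this, Matrix.mulVec_smul, Matrix.mulVec_sub, hp, hm, ← smul_neg, neg_sub_neg, neg_sub]
  have hcoord (i : Fin 2) : U (Sum.inl i) (Sum.inl 0) + U (Sum.inl i) (Sum.inl 1) = -1 ∧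
      U (Sum.inl i) (Sum.inl 0) - U (Sum.inl i) (Sum.inl 1) = ![1, -1] i := by
    have h₁ := congrFun hs (Sum.inl i)
    have h₂ := congrFun hd (Sum.inl i)
    simp [Matrix.mulVec, dotProduct] at h₁ h₂
    exact ⟨h₁, by rw [← h₂]; ring⟩
  obtain ⟨a, b⟩ := hcoord 0
  obtain ⟨c, d⟩ := hcoord 1
  simp only [Matrix.cons_val_zero, Matrix.cons_val_one] at b d
  exact ⟨by linear_combination (c + d) / 2, by linear_combination (a - b) / 2⟩

/-! ### Eigenvectors of the toroidal grid -/

open SimpleGraph in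
theorem cycleGraph_boxProd_isRegularOfDegree {m n : ℕ} (hm : 3 ≤ m) (hn : 3 ≤ n)
    [(cycleGraph m □ cycleGraph n).LocallyFinite] :
    (cycleGraph m □ cycleGraph n).IsRegularOfDegree 4 := by
  obtain ⟨m, rfl⟩ := Nat.exists_eq_add_of_le' hm
  obtain ⟨n, rfl⟩ := Nat.exists_eq_add_of_le' hn
  intro x
  rw [degree_boxProd, cycleGraph_degree_three_le, cycleGraph_degree_three_le]

open SimpleGraph in
/-- The character of the second factor given by an `n`-th root of unity, lifted to the product.
The first factor, which is `2`-regular, contributes `2` to the eigenvalue. -/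
theorem adjMatrix_cycleGraph_boxProd_mulVec {m n : ℕ}
    [DecidableRel (cycleGraph m □ cycleGraph n).Adj] (hm : 3 ≤ m) (hn : 3 ≤ n) {ζ : ℂ}
    (hζ : ζ ^ n = 1) :
    (cycleGraph m □ cycleGraph n).adjMatrix ℂ *ᵥ (fun x => ζ ^ x.2.val) =
      (2 + ζ + ζ⁻¹) • fun x => ζ ^ x.2.val := by
  obtain ⟨m, rfl⟩ := Nat.exists_eq_add_of_le' hm
  obtain ⟨n, rfl⟩ := Nat.exists_eq_add_of_le' hn
  have hζ₀ : ζ ≠ 0 := by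
    rintro rfl
    simp at hζ
  have hsucc (y : Fin (n + 3)) : ζ ^ (y + 1).val = ζ ^ y.val * ζ := by
    rw [Fin.val_add, ← pow_eq_pow_mod _ hζ, pow_add]
    simp
  have hpred (y : Fin (n + 3)) : ζ ^ (y - 1).val = ζ ^ y.val * ζ⁻¹ := by
    rw [eq_mul_inv_iff_mul_eq₀ hζ₀, ← hsucc, sub_add_cancel]
  have hne (y : Fin (n + 3)) : y - 1 ≠ y + 1 := by
    simp only [ne_eq, sub_eq_iff_eq_add, add_assoc y, left_eq_add]
    exact ne_of_beq_false rfl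
  ext ⟨x, y⟩
  rw [adjMatrix_mulVec_apply, neighborFinset_boxProd, Finset.sum_disjUnion, Finset.sum_product,
    Finset.sum_product]
  simp only [Finset.sum_singleton, Finset.sum_const, card_neighborFinset_eq_degree]
  rw [cycleGraph_degree_three_le, cycleGraph_neighborFinset, Finset.sum_pair (hne y), hsucc, hpred]
  simp
  ring

/-- A case of Niven's theorem. -/
theorem irrational_cos_two_pi_div {n : ℕ} (hn : Odd n) (h : 3 < n) :
    Irrational (Real.cos (2 * Real.pi / n)) := by
  have hden : ((2 : ℚ) / n).den = n := by
    have := Rat.den_div_eq_of_coprime (a := 2) (b := n) (by omega)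
      (by simpa using (Nat.coprime_two_left.2 hn))
    rw [Int.cast_ofNat, Int.cast_natCast] at this
    exact_mod_cast this
  have := irrational_cos_rat_mul_pi (r := 2 / n) (by rw [hden]; exact h)
  convert this using 2
  push_cast
  ring

/-! ### Double cones over toroidal grids -/

open SimpleGraph in
open Classical in
/-- The double cone has the eigenvalues `0`, `2(2l+1)` and `2 + 2cos(2π/n)`. The last one is
irrational by Niven's theorem, which contradicts the ratio condition. -/
theorem not_isPeriodicGraph_doubleCone_cycleGraph_boxProd {l m n : ℕ} (hm : 3 ≤ m) (hn : 3 < n)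
    (hodd : Odd n) (hmn : (m * n : ℂ) = 2 * (2 * l - 1) * (2 * l + 1)) :
    ¬ IsPeriodicGraph (doubleCone (cycleGraph m □ cycleGraph n)) := by
  intro hG
  have : NeZero m := ⟨by omega⟩
  have : NeZero n := ⟨by omega⟩
  set ζ : ℂ := Complex.exp (2 * Real.pi * Complex.I / n)
  have hζ : IsPrimitiveRoot ζ n := Complex.isPrimitiveRoot_exp _ (by omega)
  set c : ℝ := Real.cos (2 * Real.pi / n)
  have hc : Irrational c := irrational_cos_two_pi_div hodd hn
  have hζc : 2 + ζ + ζ⁻¹ = ((2 + 2 * c : ℝ) : ℂ) := by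
    have : ζ + ζ⁻¹ = 2 * (c : ℂ) := by
      simp only [c, ζ, Complex.ofReal_cos, Complex.cos, ← Complex.exp_neg]
      push_cast
      ring_nf
    push_cast
    rw [add_assoc, this]
  have hβ : Irrational (2 + 2 * c) := by
    exact_mod_cast (hc.ratCast_mul (q := 2) two_ne_zero).ratCast_add 2
  have hα : (2 * (2 * l + 1) : ℝ) = ((2 * (2 * l + 1) : ℕ) : ℝ) := by push_cast; ring
  have hsum : ∑ x : Fin m × Fin n, ζ ^ x.2.val = 0 := by
    rw [Fintype.sum_prod_type]
    simp only [Fin.sum_univ_eq_sum_range (fun i => ζ ^ i), hζ.geom_sum_eq_zero (by omega : 1 < n)]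
    simp
  have hv := adjMatrix_doubleCone_mulVec_symm (cycleGraph_boxProd_isRegularOfDegree hm hn.le)
    (α := 2 * l - 1) (θ := ((2 * (2 * l + 1) : ℝ) : ℂ)) (by push_cast; ring)
    (by
      rw [Fintype.card_prod, Fintype.card_fin, Fintype.card_fin, Nat.cast_mul, hmn]
      push_cast
      ring)
  have hw := adjMatrix_doubleCone_mulVec_base
    (adjMatrix_cycleGraph_boxProd_mulVec hm hn.le hζ.pow_eq_one) hsum
  rw [hζc] at hw
  refine IsPeriodicGraph.not_irrational_div hG (by positivity) hβ.ne_zero ?_ ?_ ?_ ?_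
    (adjMatrix_doubleCone_mulVec_antisymm _) hv hw ?_
  · rw [hα]
    exact (hβ.ne_nat _).symm
  · exact fun h => one_ne_zero (congrFun h (Sum.inl 0))
  · exact fun h => one_ne_zero (congrFun h (Sum.inr (0, 0)))
  · exact fun h => pow_ne_zero _ (hζ.ne_zero (by omega)) (congrFun h (Sum.inr (0, 0)))
  · rw [hα]
    exact hβ.div_natCast (by omega)

theorem not_isPeriodicGraph_coneGrid {l : ℕ} (hl : 2 ≤ l) : ¬ IsPeriodicGraph (coneGrid l) :=
  not_isPeriodicGraph_doubleCone_cycleGraph_boxProd (l := l) (by omega) (by omega)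
    (odd_two_mul_add_one l) (by simp [Nat.cast_sub (show 1 ≤ 2 * l by omega)])

theorem coneGrid_connected {l : ℕ} (hl : 2 ≤ l) : (coneGrid l).Connected := by
  have : Nonempty (Fin (2 * (2 * l - 1)) × Fin (2 * l + 1)) := ⟨(⟨0, by omega⟩, 0)⟩
  exact doubleCone_connected _

theorem perfectStateTransferAt_coneGrid {l : ℕ} (hl : 2 ≤ l) :
    PerfectStateTransferAt (coneGrid l) (Sum.inl 0) (Sum.inl 1) (Real.pi / 2) ∧
      PerfectStateTransferAt (coneGrid l) (Sum.inl 1) (Sum.inl 0) (Real.pi / 2) := by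
  classical
  have h := walkMatrix_doubleCone_pi_div_two (l := l) (by omega)
    (cycleGraph_boxProd_isRegularOfDegree (m := 2 * (2 * l - 1)) (n := 2 * l + 1)
      (by omega) (by omega))
    (by simp [Nat.cast_sub (show 1 ≤ 2 * l by omega)])
  exact ⟨by simp [PerfectStateTransferAt, coneGrid, h.1],
    by simp [PerfectStateTransferAt, coneGrid, h.2]⟩

theorem mainTheorem3 :
    (∀ l : ℕ, 2 ≤ l →
      (coneGrid l).Connected ∧ ¬ IsPeriodicGraph (coneGrid l) ∧
        ∃ t : ℝ, 0 < t ∧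
          PerfectStateTransferAt (coneGrid l) (Sum.inl 0) (Sum.inl 1) t ∧
          PerfectStateTransferAt (coneGrid l) (Sum.inl 1) (Sum.inl 0) t) ∧
    {n : ℕ | ∃ (V : Type) (_ : Fintype V) (G : SimpleGraph V),
      Fintype.card V = n ∧ G.Connected ∧ ¬ IsPeriodicGraph G ∧
        ∃ (a b : V) (t : ℝ), a ≠ b ∧ PerfectStateTransferAt G a b t}.Infinite := by
  refine ⟨fun l hl => ⟨coneGrid_connected hl, not_isPeriodicGraph_coneGrid hl, Real.pi / 2,
    by positivity, perfectStateTransferAt_coneGrid hl⟩, ?_⟩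
  refine Set.infinite_of_injective_forall_mem
    (f := fun k : ℕ => 2 + 2 * (2 * k + 3) * (2 * k + 5)) ?_ ?_
  · refine StrictMono.injective fun a b hab => ?_
    gcongr
  · intro k
    have hk : 2 ≤ k + 2 := by omega
    refine ⟨_, inferInstance, coneGrid (k + 2), ?_, coneGrid_connected hk,
      not_isPeriodicGraph_coneGrid hk, Sum.inl 0, Sum.inl 1, Real.pi / 2, by simp,
      (perfectStateTransferAt_coneGrid hk).1⟩
    simp only [Fintype.card_sum, Fintype.card_prod, Fintype.card_fin]
    rw [show 2 * (k + 2) - 1 = 2 * k + 3 by omega, show 2 * (k + 2) + 1 = 2 * k + 5 by omega]
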